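/- Let $n\ge 3$, let $\mathbb B^2$ be the closed unit disc and $\mathbb T=\mathbb B^2\times(\mathbb S^1)^{n-2}$. Let $(\mathbb B^2\times\mathbb S^1;\varphi_1,\varphi_2)$ be an initial package for the Bing double, i.e. $\varphi_1,\varphi_2$ are smooth embeddings of the solid torus into its interior with disjoint images, whose core curves $\varphi_i(\{0\}\times\mathbb S^1)$ form, up to a diffeomorphism of the solid torus, the Bing double. Let $\tilde\varphi_i=(\varphi_i\times\mathrm{id}_{(\mathbb S^1)^{n-3}})\circ(\mathrm{id}_{\mathbb B^2}\times\psi)\colon\mathbb T\to\mathbb T$, where $\psi(x_1,\dots,x_{n-2})=(x_{n-2},x_1,\dots,x_{n-3})$. For a finite word $w=i_1\cdots i_l$ in the letters $1,2$ let $|w|=l$, $\tilde\varphi_w=\tilde\varphi_{i_1}\circ\cdots\circ\tilde\varphi_{i_l}$ ($\tilde\varphi_\emptyset=\mathrm{id}$) and $\mathbb T_w=\tilde\varphi_w(\mathbb T)$, and let $\mathcal S=\bigcap_{l\ge0}\bigcup_{|w|=l}\mathbb T_w$. A set $t\subset\mathbb T_w$ is a core torus of $\mathbb T_w$ if $t=\theta(\{0\}\times(\mathbb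 S^1)^{n-2})$ for some homeomorphism $\theta\colon\mathbb T\to\mathbb T_w$. Let $\mathcal S_w$ be the family of all core tori $t$ of $\mathbb T_w$ with $t\subset\mathbb T_w\setminus(\mathbb T_{w1}\cup\mathbb T_{w2})$. Let $\vartheta\colon\mathbb T\to\mathbb S^n$ be a smooth embedding, and let $\mathbb S^n/\mathrm{BB}$ be the quotient of $\mathbb S^n$ in which each component of $\vartheta(\mathcal S)$ is collapsed to a point. Let $\hat\rho\colon\mathbb S^n\to\mathbb S^n$ be a shrinking map: $\hat\rho$ is the composition of the quotient map $\mathbb S^n\to\mathbb S^n/\mathrm{BB}$ with a homeomorphism $\mathbb S^n/\mathrm{BB}\to\mathbb S^n$, and it restricts to a diffeomorphism $\mathbb S^n\setminus\vartheta(\mathcal S)\to\mathbb S^n\setminus E$, where $E=\hat\rho(\vartheta(\mathcal S))$. Let $\lambda\in(0,1)$ and let $d$ be a metric on $\mathbb S^n$, inducing the standard topology, such that (a) $d$ is almost smooth with singular set $E$: it is the completion of the Riemannian distance of a smooth Riemannian metric on $\mathbb S^n\setminus E$; and (b) $d$ is a Semmes metric with scaling constant $\lambda$: there is $L\ge1$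 such that, for $d'(x,y)=d(\hat\rho(\vartheta(x)),\hat\rho(\vartheta(y)))$, $$\frac{\lambda^{|w|}}{L}\,d'(x,y)\le d'(\tilde\varphi_w(x),\tilde\varphi_w(y))\le L\lambda^{|w|}\,d'(x,y)$$ for all $x,y\in\mathbb T$ and all words $w$. For each word $w$ let $\mathscr S_w=\{\hat\rho(\vartheta(t)) : t\in\mathcal S_w\}$. Then there is a constant $c_0>0$, depending only on the data $(\varphi_1,\varphi_2,\vartheta,\hat\rho,\lambda,d)$, such that $$\operatorname{Mod}_{\frac n{n-2},d}(\mathscr S_w)\ge c_0\qquad\text{for every word } w.$$ Here $\operatorname{Mod}_{p,d}(\mathscr S)=\inf_\rho\int_{\mathbb S^n}\rho^{p}\,d\mathcal H^n_d$ for a family $\mathscr S$ of $(n-2)$-tori, where the infimum is over all Borel functions $\rho\colon\mathbb S^n\to[0,\infty]$ with $\int_S\rho\,d\mathcal H^{n-2}_d\ge1$ for all $S\in\mathscr S$, and $\mathcal H^m_d$ is the Hausdorff $m$-measure of $(\mathbb S^n,d)$. -/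

import Mathlib

open Set Topology Manifold MeasureTheory
open scoped ENNReal ContDiff Bundle

noncomputable section

namespace BingBlankinship

/-! ### Smooth maps between compact submanifolds of Euclidean spaces -/

/-- A map `f : X → Y` between spaces that are realised as compact subsets `a(X) ⊆ E`, `b(Y) ⊆ F` of
normed spaces is smooth (up to the boundary, if there is one) if it is the restriction of a smooth
map `E → F`. -/
def IsSmooth {X Y E F : Type*} [NormedAddCommGroup E] [NormedSpace ℝ E]
    [NormedAddCommGroup F] [NormedSpace ℝ F] (a : X → E) (b : Y → F) (f : X → Y) : Prop :=
  ∃ g : E → F, ContDiff ℝ ∞ g ∧ ∀ x, g (a x) = b (f x)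

/-- A smooth embedding is a smooth map that is a diffeomorphism onto its image, i.e. it is smooth
and its inverse `f(X) → X` is (injectivity of `f` follows) the restriction of a smooth map. -/
def IsSmoothEmbedding {X Y E F : Type*} [NormedAddCommGroup E] [NormedSpace ℝ E]
    [NormedAddCommGroup F] [NormedSpace ℝ F] (a : X → E) (b : Y → F) (f : X → Y) : Prop :=
  IsSmooth a b f ∧ ∃ h : F → E, ContDiff ℝ ∞ h ∧ ∀ x, h (b (f x)) = a x

/-! ### Tubes -/

/-- The closed unit disc `𝔹²`. -/
abbrev Disc : Type := Metric.closedBall (0 : ℂ) 1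

/-- The solid torus `𝔹² × 𝕊¹`. -/
abbrev SolidTorus : Type := Disc × Circle

/-- The standard `n`-tube `𝕋 = 𝔹² × (𝕊¹)ⁿ⁻²`, where `n = k + 3`. -/
abbrev Tube (k : ℕ) : Type := Disc × (Fin (k + 1) → Circle)

/-- The solid torus as a subset of `ℂ × ℂ`. -/
def SolidTorus.coords (p : SolidTorus) : ℂ × ℂ := ((p.1 : ℂ), (p.2 : ℂ))

/-- The tube as a subset of `ℂ × ℂⁿ⁻²`. -/
def Tube.coords {k : ℕ} (p : Tube k) : ℂ × (Fin (k + 1) → ℂ) := ((p.1 : ℂ), fun j => (p.2 j : ℂ))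

/-! ### The Bing double -/

/-- The two core curves of the standard Bing double in `𝔹² × 𝕊¹`. The curve with index `0` lies in
the slice where the disc coordinate is real, the one with index `1` in the slice where it is
imaginary. Each is the boundary of an embedded disc in its slice that covers an angle `4π/3 > π` of
the `𝕊¹`-direction; each curve meets the disc of the other one in two points, with opposite signs, so
that the two curves clasp each other at both of their ends. -/
def bingCurve : Fin 2 → Set SolidTorus
  | 0 => {p | ∃ s : ℝ, (p.1 : ℂ) = (Real.cos s / 2 : ℝ) ∧
      p.2 = Circle.exp (2 * Real.pi / 3 * Real.sin s)}
  | 1 => {p | ∃ s : ℝ, (p.1 : ℂ) = (Real.cos s / 2 : ℝ) * Complex.I ∧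
      p.2 = Circle.exp (Real.pi + 2 * Real.pi / 3 * Real.sin s)}

/-- An initial package `(𝔹² × 𝕊¹; φ₁, φ₂)` for the Bing double: two smooth embeddings of the solid
torus into its interior with disjoint images, whose core curves form, up to a diffeomorphism of the
solid torus, the Bing double. -/
structure BingPackage where
  /-- the two embeddings -/
  φ : Fin 2 → SolidTorus → SolidTorus
  smoothEmbedding : ∀ i, IsSmoothEmbedding SolidTorus.coords SolidTorus.coords (φ i)
  mapsTo_interior : ∀ i p, ‖((φ i p).1 : ℂ)‖ < 1
  disjoint : Disjoint (range (φ 0)) (range (φ 1))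
  bing : ∃ h : SolidTorus ≃ SolidTorus,
    IsSmooth SolidTorus.coords SolidTorus.coords h ∧
    IsSmooth SolidTorus.coords SolidTorus.coords h.symm ∧
    ∀ i, h '' (φ i '' {p | (p.1 : ℂ) = 0}) = bingCurve i

/-- The cyclic permutation `(x₁, …, xₙ₋₂) ↦ (xₙ₋₂, x₁, …, xₙ₋₃)` of `(𝕊¹)ⁿ⁻²` (the subtraction in
`Fin (k + 1)` is cyclic). -/
def cyc {k : ℕ} (x : Fin (k + 1) → Circle) : Fin (k + 1) → Circle := fun j => x (j - 1)

namespace BingPackage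

/-- The Bing–Blankinship package: `φ̃ᵢ = (φᵢ × id) ∘ (id × ψ)`, where `ψ` is the cyclic permutation
and `φᵢ × id` acts by `φᵢ` on the disc and the first circle. -/
def bb (P : BingPackage) (k : ℕ) (i : Fin 2) (p : Tube k) : Tube k :=
  ((P.φ i (p.1, cyc p.2 0)).1, Function.update (cyc p.2) 0 (P.φ i (p.1, cyc p.2 0)).2)

/-- `φ̃_w = φ̃_{i₁} ∘ ⋯ ∘ φ̃_{iₗ}` for a word `w = i₁ ⋯ iₗ`. -/
def word (P : BingPackage) (k : ℕ) : List (Fin 2) → Tube k → Tube k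
  | [] => id
  | i :: w => P.bb k i ∘ P.word k w

/-- The Blankinship ring `𝕋_w = φ̃_w(𝕋)`. -/
def ring (P : BingPackage) (k : ℕ) (w : List (Fin 2)) : Set (Tube k) := range (P.word k w)

/-- The singular set `⋂ₗ ⋃_{|w| = l} 𝕋_w` of the package. -/
def singularSet (P : BingPackage) (k : ℕ) : Set (Tube k) :=
  ⋂ l : ℕ, ⋃ w ∈ {w : List (Fin 2) | w.length = l}, P.ring k w

end BingPackage

/-- `t` is a core torus of the `n`-tube `T`: the image of `{0} × (𝕊¹)ⁿ⁻²` under a homeomorphism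
`𝔹² × (𝕊¹)ⁿ⁻² → T`. -/
def IsCoreTorus {k : ℕ} {X : Type*} [TopologicalSpace X] (T t : Set X) : Prop :=
  ∃ θ : Tube k ≃ₜ T, t = (fun p => (θ p : X)) '' {p | (p.1 : ℂ) = 0}

/-- The family `𝒮_w` of all core tori of `𝕋_w` that are contained in
`𝕋_w ∖ (𝕋_{w1} ∪ 𝕋_{w2})`. -/
def BingPackage.coreTori (P : BingPackage) (k : ℕ) (w : List (Fin 2)) : Set (Set (Tube k)) :=
  {t | IsCoreTorus (k := k) (P.ring k w) t ∧
    t ⊆ P.ring k w \ (P.ring k (w ++ [0]) ∪ P.ring k (w ++ [1]))}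

/-! ### Decomposition spaces -/

/-- The equivalence relation on `X` whose classes are the connected components of `K` and the
points of `X ∖ K`. -/
def collapse {X : Type*} [TopologicalSpace X] (K : Set X) : Setoid X where
  r x y := x = y ∨ (x ∈ K ∧ y ∈ connectedComponentIn K x)
  iseqv := by
    refine ⟨fun x => Or.inl rfl, ?_, ?_⟩
    · rintro x y (rfl | ⟨hx, hy⟩)
      · exact Or.inl rfl
      · refine Or.inr ⟨connectedComponentIn_subset _ _ hy, ?_⟩
        rw [← connectedComponentIn_eq hy]
        exact mem_connectedComponentIn hx
    · rintro x y z (rfl | ⟨hx, hy⟩) (rfl | ⟨hy', hz⟩)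
      · exact Or.inl rfl
      · exact Or.inr ⟨hy', hz⟩
      · exact Or.inr ⟨hx, hy⟩
      · refine Or.inr ⟨hx, ?_⟩
        rwa [connectedComponentIn_eq hy]

/-! ### Metrics on the sphere, and the modulus -/

/-- The unit sphere `𝕊ⁿ ⊆ ℝⁿ⁺¹`, where `n = k + 3`. -/
abbrev Sph (k : ℕ) : Type := Metric.sphere (0 : EuclideanSpace ℝ (Fin (k + 3 + 1))) 1

/-- A metric on `X` that induces the given topology of `X`. -/
structure CompatibleMetric (X : Type*) [TopologicalSpace X] where
  /-- the distance function -/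
  d : X → X → ℝ
  d_self : ∀ x, d x x = 0
  d_comm : ∀ x y, d x y = d y x
  d_triangle : ∀ x y z, d x z ≤ d x y + d y z
  eq_of_d_eq_zero : ∀ x y, d x y = 0 → x = y
  isOpen_iff : ∀ s : Set X, IsOpen s ↔ ∀ x ∈ s, ∃ ε > 0, ∀ y, d x y < ε → y ∈ s

/-- The metric space `(X, d)`: a copy of `X` that carries the metric `d`. -/
def CompatibleMetric.Space {X : Type*} [TopologicalSpace X] (_D : CompatibleMetric X) : Type _ := X

instance {X : Type*} [TopologicalSpace X] (D : CompatibleMetric X) : MetricSpace D.Space :=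
  letI : TopologicalSpace D.Space := inferInstanceAs (TopologicalSpace X)
  MetricSpace.ofDistTopology D.d D.d_self D.d_comm D.d_triangle D.isOpen_iff D.eq_of_d_eq_zero

instance {X : Type*} [TopologicalSpace X] (D : CompatibleMetric X) : MeasurableSpace D.Space :=
  borel D.Space

instance {X : Type*} [TopologicalSpace X] (D : CompatibleMetric X) : BorelSpace D.Space := ⟨rfl⟩

/-- The `p`-modulus of a family `𝒮` of `l`-dimensional subsets of a metric space `X` that is equipped
with its Hausdorff `n`-measure. -/
def modulus {X : Type*} [MetricSpace X] [MeasurableSpace X] [BorelSpace X]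
    (n l : ℕ) (p : ℝ) (𝒮 : Set (Set X)) : ℝ≥0∞ :=
  ⨅ (ρ : X → ℝ≥0∞) (_ : Measurable ρ) (_ : ∀ S ∈ 𝒮, 1 ≤ ∫⁻ x in S, ρ x ∂(μH[(l : ℝ)])),
    ∫⁻ x, ρ x ^ p ∂(μH[(n : ℝ)])

/-- The Riemannian distance (the infimum of the lengths of the `C¹` paths) of a smooth Riemannian
metric `g` on a manifold `M`. -/
def riemannDist {E H M : Type*} [NormedAddCommGroup E] [NormedSpace ℝ E] [TopologicalSpace H]
    {I : ModelWithCorners ℝ E H} [TopologicalSpace M] [ChartedSpace H M] [IsManifold I ∞ M]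
    (g : Bundle.ContMDiffRiemannianMetric I ∞ E (fun x : M => TangentSpace I x)) (x y : M) : ℝ≥0∞ :=
  letI : Bundle.RiemannianBundle (fun x : M => TangentSpace I x) := ⟨g.toRiemannianMetric⟩
  Manifold.riemannianEDist I x y

/-! ### The data of a Semmes space -/

/-- A smooth embedding of the tube into the sphere, together with the package for the Bing
double. -/
structure Placement (k : ℕ) where
  /-- the package for the Bing double -/
  P : BingPackage
  /-- the embedding of the tube into the sphere -/
  ϑ : Tube k → Sph k
  smoothEmbedding : IsSmoothEmbedding Tube.coords
    (Subtype.val : Sph k → EuclideanSpace ℝ (Fin (k + 3 + 1))) ϑ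

/-- The image `ϑ(𝒮(ℑ))` in `𝕊ⁿ` of the singular set of the package. -/
def Placement.sing {k : ℕ} (A : Placement k) : Set (Sph k) := A.ϑ '' A.P.singularSet k

/-- The decomposition space `𝕊ⁿ/BB`: the components of `ϑ(𝒮(ℑ))` are collapsed to points. -/
abbrev Placement.QuotientSpace {k : ℕ} (A : Placement k) : Type := Quotient (collapse A.sing)

/-- A Bing–Blankinship shrinking map: a map `𝕊ⁿ → 𝕊ⁿ` that factors through a homeomorphism
`𝕊ⁿ/BB → 𝕊ⁿ` and restricts to a diffeomorphism from the complement of the singular set onto the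
complement of its image. -/
structure ShrinkingMap {k : ℕ} (A : Placement k) where
  /-- the map -/
  ρ : Sph k → Sph k
  factors : ∃ h : A.QuotientSpace ≃ₜ Sph k, ∀ x, ρ x = h (Quotient.mk _ x)
  bijOn : BijOn ρ A.singᶜ (ρ '' A.sing)ᶜ
  contMDiffOn : ContMDiffOn (𝓡 (k + 3)) (𝓡 (k + 3)) ∞ ρ A.singᶜ
  contMDiffOn_inv : ∃ σ : Sph k → Sph k,
    ContMDiffOn (𝓡 (k + 3)) (𝓡 (k + 3)) ∞ σ (ρ '' A.sing)ᶜ ∧ LeftInvOn σ ρ A.singᶜ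

section Closed

theorem SolidTorus.continuous_of_isSmooth {f : SolidTorus → SolidTorus}
    (hf : IsSmooth SolidTorus.coords SolidTorus.coords f) : Continuous f := by
  obtain ⟨g, hg, h⟩ := hf
  have h1 : Continuous fun p : SolidTorus => SolidTorus.coords (f p) := by
    simp_rw [← h]
    refine hg.continuous.comp ?_
    unfold SolidTorus.coords
    fun_prop
  refine Continuous.prodMk ?_ ?_
  · exact Topology.IsInducing.subtypeVal.continuous_iff.2 (continuous_fst.comp h1)
  · exact (Topology.IsInducing.subtypeVal : IsInducing (Subtype.val : Circle → ℂ)).continuous_iff.2 (continuous_snd.comp h1)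

theorem BingPackage.continuous_bb (P : BingPackage) (k : ℕ) (i : Fin 2) :
    Continuous (P.bb k i) := by
  have hφ := SolidTorus.continuous_of_isSmooth (P.smoothEmbedding i).1
  have hc : Continuous fun p : Tube k => cyc p.2 := by
    unfold cyc; fun_prop
  have h0 : Continuous fun p : Tube k => P.φ i (p.1, cyc p.2 0) :=
    hφ.comp (continuous_fst.prodMk ((continuous_apply 0).comp hc))
  exact (continuous_fst.comp h0).prodMk (hc.update 0 (continuous_snd.comp h0))

theorem BingPackage.continuous_word (P : BingPackage) (k : ℕ) (w : List (Fin 2)) :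
    Continuous (P.word k w) := by
  induction w with
  | nil => exact continuous_id
  | cons i w ih => exact (P.continuous_bb k i).comp ih

theorem BingPackage.isCompact_singularSet (P : BingPackage) (k : ℕ) :
    IsCompact (P.singularSet k) := by
  have : CompactSpace Disc := isCompact_iff_compactSpace.1 (isCompact_closedBall _ _)
  refine IsClosed.isCompact (isClosed_iInter fun l => ?_)
  refine (List.finite_length_eq (Fin 2) l).isClosed_biUnion fun w _ => ?_
  exact (isCompact_range (P.continuous_word k w)).isClosed

theorem Placement.isCompact_sing {k : ℕ} (A : Placement k) : IsCompact A.sing := by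
  refine (A.P.isCompact_singularSet k).image ?_
  obtain ⟨g, hg, h⟩ := A.smoothEmbedding.1
  refine Topology.IsInducing.subtypeVal.continuous_iff.2 ?_
  have : (Subtype.val ∘ A.ϑ : Tube k → EuclideanSpace ℝ (Fin (k + 3 + 1)))
      = fun p => g p.coords := by
    funext p; exact (h p).symm
  rw [this]
  refine hg.continuous.comp ?_
  unfold Tube.coords
  fun_prop

theorem ShrinkingMap.continuous {k : ℕ} {A : Placement k} (R : ShrinkingMap A) :
    Continuous R.ρ := by
  obtain ⟨h, hh⟩ := R.factors
  have : R.ρ = fun x => h (Quotient.mk _ x) := funext hh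
  rw [this]
  exact h.continuous.comp continuous_quotient_mk'

end Closed

/-- The open set `𝕊ⁿ ∖ E`, where `E = ρ(ϑ(𝒮(ℑ)))` is the Bing–Blankinship Cantor set. -/
def ShrinkingMap.regular {k : ℕ} {A : Placement k} (R : ShrinkingMap A) :
    TopologicalSpace.Opens (Sph k) :=
  ⟨(R.ρ '' A.sing)ᶜ, (A.isCompact_sing.image R.continuous).isClosed.isOpen_compl⟩

/-- `d` is an almost smooth metric with singular set `𝕊ⁿ ∖ U`: it is the completion of the Riemannian
distance of a smooth Riemannian metric on `U`. As `d` is a metric of the compact space `𝕊ⁿ`, and as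
the complement of `U` is nowhere dense in the situation considered here, this means that `d` restricts
to the Riemannian distance on `U`. -/
def IsAlmostSmooth {k : ℕ} (D : CompatibleMetric (Sph k))
    (U : TopologicalSpace.Opens (Sph k)) : Prop :=
  ∃ g : Bundle.ContMDiffRiemannianMetric (𝓡 (k + 3)) ∞ (EuclideanSpace ℝ (Fin (k + 3)))
      (fun x : U => TangentSpace (𝓡 (k + 3)) x),
    ∀ x y : U, ENNReal.ofReal (D.d x y) = riemannDist g x y

/-- The Semmes condition with scaling constant `lam`, for the metric `d'(x, y) = d(ρ(ϑ(x)), ρ(ϑ(y)))`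
on the decomposition space of the tube. The points `x`, `y` of that space are represented by points
of the tube. -/
def IsSemmesMetric {k : ℕ} {A : Placement k} (R : ShrinkingMap A) (D : CompatibleMetric (Sph k))
    (lam : ℝ) : Prop :=
  ∃ L : ℝ, 1 ≤ L ∧ ∀ (w : List (Fin 2)) (x y : Tube k),
    lam ^ w.length / L * D.d (R.ρ (A.ϑ x)) (R.ρ (A.ϑ y)) ≤
        D.d (R.ρ (A.ϑ (A.P.word k w x))) (R.ρ (A.ϑ (A.P.word k w y))) ∧
      D.d (R.ρ (A.ϑ (A.P.word k w x))) (R.ρ (A.ϑ (A.P.word k w y))) ≤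
        L * lam ^ w.length * D.d (R.ρ (A.ϑ x)) (R.ρ (A.ϑ y))

/-- The data of a Semmes space `(𝕊ⁿ, d)`, where `n = k + 3`: a package for the Bing double, a smooth
embedding of the tube into the sphere, a Bing–Blankinship shrinking map, a scaling constant in
`(0, 1)`, and an almost smooth Semmes metric whose singular set is the Bing–Blankinship Cantor
set. -/
structure SemmesData (k : ℕ) where
  /-- the package and the embedding of the tube -/
  A : Placement k
  /-- the shrinking map -/
  R : ShrinkingMap A
  /-- the scaling constant -/
  lam : ℝ
  lam_pos : 0 < lam
  lam_lt_one : lam < 1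
  /-- the metric -/
  D : CompatibleMetric (Sph k)
  almostSmooth : IsAlmostSmooth D R.regular
  semmes : IsSemmesMetric R D lam

/-- The family `{ρ(ϑ(t)) : t ∈ 𝒮_w}` of `(n-2)`-tori in the Semmes space `(𝕊ⁿ, d)`. -/
def SemmesData.tori {k : ℕ} (S : SemmesData k) (w : List (Fin 2)) : Set (Set S.D.Space) :=
  {s | ∃ t ∈ S.A.P.coreTori k w, s = (fun p => S.R.ρ (S.A.ϑ p)) '' t}

end BingBlankinship

end

/-!
The modulus of `𝒮_w` is bounded below by that of an explicit subfamily. The embeddings `φᵢ` map into the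
interior of the tube, so there is a disc `B` in the interior of `𝔹²`, close to the boundary, such that
the tori `{z} × (𝕊¹)ⁿ⁻²`, `z ∈ B`, avoid the images of `φ̃₁` and `φ̃₂`. Each of them is a core torus, because
Möbius transformations move `0` to `z`, so that its image under `φ̃_w` belongs to `𝒮_w`
(`BingPackage.image_fiber_mem_coreTori`).

Over `B` the tube avoids the singular set, so that `ρ ∘ ϑ` is there a smooth embedding into the Riemannian
manifold `𝕊ⁿ ∖ E`, and therefore locally bilipschitz for the Riemannian distance `d`
(`exists_bilipschitz_riemannianEDist`, `SemmesData.exists_bilipschitz_tubeParam`). By the Semmes condition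
`ρ ∘ ϑ ∘ φ̃_w` is there locally bilipschitz up to the factor `λ^|w|`, with a constant that does not depend
on `w`.

For an admissible function one integrates the inequality `1 ≤ ∫_S ρ dℋⁿ⁻²` over the tori of the
subfamily, changes variables with the upper Lipschitz bound, applies Hölder's inequality on the parameter
space, and changes variables again with the lower bound in dimension `n`. For the exponent `n/(n-2)` the powers
of `λ^|w|` cancel (`exists_le_modulus_of_slices`).
-/

noncomputable section

namespace BingBlankinship

open scoped NNReal

/-! ### Hausdorff measures under Lipschitz and antilipschitz maps -/

section ChangeOfVariables

variable {X Y : Type*} [MetricSpace X] [MeasurableSpace X] [BorelSpace X]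
  [MetricSpace Y] [MeasurableSpace Y] [BorelSpace Y]

/-- No injectivity is needed: the image measure counts every point of `f '' s` at least once. -/
theorem setLIntegral_image_hausdorffMeasure_le {f : X → Y} (hf : Measurable f) {s : Set X}
    {K : ℝ≥0} (hK : LipschitzOnWith K f s) {d : ℝ} (hd : 0 ≤ d) {ρ : Y → ℝ≥0∞}
    (hρ : Measurable ρ) :
    ∫⁻ y in f '' s, ρ y ∂μH[d] ≤ (K : ℝ≥0∞) ^ d * ∫⁻ x in s, ρ (f x) ∂μH[d] := by
  have key : (μH[d] : Measure Y).restrict (f '' s) ≤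
      ((K : ℝ≥0∞) ^ d) • ((μH[d] : Measure X).restrict s).map f := by
    refine Measure.le_iff.2 fun B hB => ?_
    rw [Measure.restrict_apply hB, Measure.smul_apply, Measure.map_apply hf hB,
      Measure.restrict_apply (hf hB), inter_comm B, ← image_inter_preimage, inter_comm s, smul_eq_mul]
    exact (hK.mono inter_subset_right).hausdorffMeasure_image_le hd
  calc ∫⁻ y in f '' s, ρ y ∂μH[d]
      ≤ ∫⁻ y, ρ y ∂(((K : ℝ≥0∞) ^ d) • ((μH[d] : Measure X).restrict s).map f) :=
        lintegral_mono' key le_rfl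
    _ = _ := by rw [lintegral_smul_measure, lintegral_map hρ hf, smul_eq_mul]

theorem setLIntegral_comp_hausdorffMeasure_le {f : X → Y} (hf : Measurable f) {s : Set X}
    {K : ℝ≥0} (hK : ∀ x ∈ s, ∀ y ∈ s, edist x y ≤ K * edist (f x) (f y)) {d : ℝ} (hd : 0 ≤ d)
    {ρ : Y → ℝ≥0∞} (hρ : Measurable ρ) :
    ∫⁻ x in s, ρ (f x) ∂μH[d] ≤ (K : ℝ≥0∞) ^ d * ∫⁻ y, ρ y ∂μH[d] := by
  have key : ((μH[d] : Measure X).restrict s).map f ≤ ((K : ℝ≥0∞) ^ d) • (μH[d] : Measure Y) := by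
    refine Measure.le_iff.2 fun B hB => ?_
    rw [Measure.map_apply hf hB, Measure.restrict_apply (hf hB), Measure.smul_apply, smul_eq_mul]
    have hanti : AntilipschitzWith K ((f ⁻¹' B ∩ s).domRestrict f) :=
      fun x y => hK _ x.2.2 _ y.2.2
    have h1 := hanti.le_hausdorffMeasure_image hd univ
    rw [image_univ, range_domRestrict] at h1
    have h2 : (μH[d] : Measure (f ⁻¹' B ∩ s : Set X)) univ = μH[d] (f ⁻¹' B ∩ s) := by
      rw [← (isometry_subtype_coe (s := f ⁻¹' B ∩ s)).hausdorffMeasure_image (Or.inl hd),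
        image_univ, Subtype.range_coe]
    rw [h2] at h1
    refine h1.trans ?_
    gcongr
    exact image_subset_iff.2 inter_subset_left
  calc ∫⁻ x in s, ρ (f x) ∂μH[d] = ∫⁻ y, ρ y ∂(((μH[d] : Measure X).restrict s).map f) :=
        (lintegral_map hρ hf).symm
    _ ≤ ∫⁻ y, ρ y ∂(((K : ℝ≥0∞) ^ d) • (μH[d] : Measure Y)) := lintegral_mono' key le_rfl
    _ = _ := by rw [lintegral_smul_measure, smul_eq_mul]

theorem setLIntegral_iUnion_fin_le {α : Type*} [MeasurableSpace α] (μ : Measure α) {N : ℕ}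
    (s : Fin N → Set α) (f : α → ℝ≥0∞) {a : ℝ≥0∞} (h : ∀ i, ∫⁻ x in s i, f x ∂μ ≤ a) :
    ∫⁻ x in ⋃ i, s i, f x ∂μ ≤ N * a := by
  refine (lintegral_iUnion_le s f).trans ?_
  rw [tsum_fintype]
  refine (Finset.sum_le_card_nsmul _ _ _ fun i _ => h i).trans ?_
  simp

end ChangeOfVariables

/-- On `ℂ × ℝᵏ⁺¹`, Lebesgue measure is a multiple of the Hausdorff measure of the maximum norm. -/
theorem exists_volume_eq_smul_hausdorffMeasure (k : ℕ) : ∃ a : ℝ≥0,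
    (volume : Measure (ℂ × (Fin (k + 1) → ℝ))) = a • μH[((k + 3 : ℕ) : ℝ)] := by
  have h : Module.finrank ℝ (ℂ × (Fin (k + 1) → ℝ)) = k + 3 := by
    rw [Module.finrank_prod, Complex.finrank_real_complex, Module.finrank_fin_fun]
    ring
  have : (μH[((k + 3 : ℕ) : ℝ)] : Measure (ℂ × (Fin (k + 1) → ℝ))).IsAddHaarMeasure := by
    rw [← h]; infer_instance
  have : (volume : Measure (ℂ × (Fin (k + 1) → ℝ))).IsAddHaarMeasure :=
    inferInstanceAs (Measure.prod _ _).IsAddHaarMeasure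
  exact ⟨_, Measure.isAddLeftInvariant_eq_smul _ _⟩

/-! ### A lower bound for the modulus of a product family -/

/-- If `K₀ × T₀` is mapped into `X` by a map `f` that is bilipschitz up to a scaling factor `s` on each of
`N` pieces, then the modulus of a family whose members lie in the slices `f({z} × T₀)`, with one member for
each `z ∈ K₀`, is bounded below independently of `s`. For the exponent `p = n/(n-2)` the powers of `s` that
come from the `(n-2)`- and the `n`-dimensional measure cancel in Hölder's inequality. -/
theorem exists_le_modulus_of_slices (k N : ℕ) (C : ℝ≥0) {K₀ : Set ℂ} {T₀ : Set (Fin (k + 1) → ℝ)}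
    (hK : MeasurableSet K₀) (hK0 : volume K₀ ≠ 0) (hKtop : volume K₀ ≠ ⊤)
    (hTtop : volume T₀ ≠ ⊤) (X : Type*) [MetricSpace X] [MeasurableSpace X] [BorelSpace X] :
    ∃ c₀ : ℝ, 0 < c₀ ∧ ∀ (f : ℂ × (Fin (k + 1) → ℝ) → X), Measurable f →
      ∀ V : Fin N → Set (ℂ × (Fin (k + 1) → ℝ)), K₀ ×ˢ T₀ ⊆ ⋃ i, V i →
      ∀ s : ℝ≥0, 0 < s → (∀ i, LipschitzOnWith (C * s) f (V i)) →
      (∀ i, ∀ x ∈ V i, ∀ y ∈ V i, edist x y ≤ (C / s : ℝ≥0) * edist (f x) (f y)) →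
      ∀ 𝒮 : Set (Set X), (∀ z ∈ K₀, ∃ S ∈ 𝒮, S ⊆ (fun x => f (z, x)) '' T₀) →
      ENNReal.ofReal c₀ ≤ modulus (k + 3) (k + 1) (((k + 3 : ℕ) : ℝ) / ((k + 1 : ℕ) : ℝ)) 𝒮 := by
  obtain ⟨a, ha⟩ := exists_volume_eq_smul_hausdorffMeasure k
  set p : ℝ := ((k + 3 : ℕ) : ℝ) / ((k + 1 : ℕ) : ℝ) with hp
  have hk1 : (0 : ℝ) < ((k + 1 : ℕ) : ℝ) := by positivity
  have hp1 : 1 < p := by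
    rw [hp, one_lt_div hk1]; push_cast; linarith
  have hp0 : 0 < p := by linarith
  have hpq : p.HolderConjugate p.conjExponent := Real.HolderConjugate.conjExponent hp1
  set q := p.conjExponent
  set B : ℝ≥0∞ := N * (C : ℝ≥0∞) ^ (k + 1) * (C : ℝ≥0∞) ^ (k + 1) *
    (volume (K₀ ×ˢ T₀)) ^ (1 / q) * (N * a : ℝ≥0∞) ^ (1 / p) with hB
  have hvol : volume (K₀ ×ˢ T₀) ≠ ⊤ := by
    rw [Measure.volume_eq_prod, Measure.prod_prod]
    exact ENNReal.mul_ne_top hKtop hTtop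
  have hBtop : B ≠ ⊤ := by
    have h1 : (volume (K₀ ×ˢ T₀)) ^ (1 / q) ≠ ⊤ :=
      ENNReal.rpow_ne_top_of_nonneg (by have := hpq.symm.pos; positivity) hvol
    have h2 : (N * a : ℝ≥0∞) ^ (1 / p) ≠ ⊤ :=
      ENNReal.rpow_ne_top_of_nonneg (by positivity) (by finiteness)
    finiteness
  -- `B + 1` instead of `B`, which vanishes if there are no pieces
  refine ⟨((volume K₀ / (B + 1)) ^ p).toReal, ?_, ?_⟩
  · refine ENNReal.toReal_pos ?_ ?_
    · refine (ENNReal.rpow_pos (ENNReal.div_pos hK0 (by finiteness)) ?_).ne'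
      exact ENNReal.div_ne_top hKtop (by simp)
    · exact ENNReal.rpow_ne_top_of_nonneg hp0.le (ENNReal.div_ne_top hKtop (by simp))
  intro f hf V hV s hs hup hlow 𝒮 h𝒮
  refine ENNReal.ofReal_toReal_le.trans ?_
  refine le_iInf fun ρ => le_iInf fun hρ => le_iInf fun hadm => ?_
  set Q := K₀ ×ˢ T₀ with hQ
  set J := ∫⁻ v in Q, ρ (f v) with hJ
  set Ip := ∫⁻ x, ρ x ^ p ∂(μH[((k + 3 : ℕ) : ℝ)] : Measure X) with hIp
  have hρf : Measurable fun v => ρ (f v) := hρ.comp hf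
  -- the upper Lipschitz bound on the slices, integrated over `z`
  have h2 : volume K₀ ≤ N * ((C * s : ℝ≥0) : ℝ≥0∞) ^ (k + 1) * J := by
    have h1 : ∀ z ∈ K₀, 1 ≤ N * ((C * s : ℝ≥0) : ℝ≥0∞) ^ (k + 1) * ∫⁻ x in T₀, ρ (f (z, x)) := by
      intro z hz
      obtain ⟨S, hS, hST⟩ := h𝒮 z hz
      have hfz : Measurable fun x => f (z, x) := hf.comp measurable_prodMk_left
      let W : Fin N → Set (Fin (k + 1) → ℝ) := fun i => T₀ ∩ (fun x => (z, x)) ⁻¹' V i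
      have hcov : (fun x => f (z, x)) '' T₀ ⊆ ⋃ i, (fun x => f (z, x)) '' W i := by
        rintro _ ⟨x, hx, rfl⟩
        obtain ⟨i, hi⟩ := mem_iUnion.1 (hV (mk_mem_prod hz hx))
        exact mem_iUnion.2 ⟨i, x, ⟨hx, hi⟩, rfl⟩
      refine (hadm S hS).trans (((lintegral_mono_set (hST.trans hcov)).trans
        (setLIntegral_iUnion_fin_le _ _ _
        (a := ((C * s : ℝ≥0) : ℝ≥0∞) ^ (k + 1) * ∫⁻ x in T₀, ρ (f (z, x))) fun i => ?_)).trans_eq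
        (mul_assoc _ _ _).symm)
      have hL : LipschitzOnWith (C * s) (fun x => f (z, x)) (W i) := by
        intro x hx y hy
        refine (hup i hx.2 hy.2).trans_eq ?_
        congr 1
        simp [Prod.edist_eq]
      refine (setLIntegral_image_hausdorffMeasure_le hfz hL hk1.le hρ).trans ?_
      have hvolH : (μH[((k + 1 : ℕ) : ℝ)] : Measure (Fin (k + 1) → ℝ)) = volume := by
        simpa using (hausdorffMeasure_pi_real (ι := Fin (k + 1)))
      rw [ENNReal.rpow_natCast, hvolH]
      gcongr
      exact inter_subset_left
    calc volume K₀ = ∫⁻ z in K₀, 1 := by simp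
      _ ≤ ∫⁻ z in K₀, N * ((C * s : ℝ≥0) : ℝ≥0∞) ^ (k + 1) * ∫⁻ x in T₀, ρ (f (z, x)) :=
        setLIntegral_mono' hK h1
      _ = N * ((C * s : ℝ≥0) : ℝ≥0∞) ^ (k + 1) * ∫⁻ z in K₀, ∫⁻ x in T₀, ρ (f (z, x)) := by
        rw [lintegral_const_mul']
        finiteness
      _ = _ := by
        rw [hJ, hQ, Measure.volume_eq_prod, ← Measure.prod_restrict,
          lintegral_prod _ hρf.aemeasurable]
  -- Hölder's inequality with the constant function `1`
  have h3 : J ≤ (∫⁻ v in Q, ρ (f v) ^ p) ^ (1 / p) * volume Q ^ (1 / q) := by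
    have := ENNReal.lintegral_mul_le_Lp_mul_Lq (volume.restrict Q) hpq (f := fun v => ρ (f v))
      (g := fun _ => 1) hρf.aemeasurable aemeasurable_const
    simpa using this
  -- the antilipschitz bound on the pieces
  have h4 : ∫⁻ v in Q, ρ (f v) ^ p ≤ (N * a : ℝ≥0∞) * ((C / s : ℝ≥0) : ℝ≥0∞) ^ (k + 3) * Ip := by
    have hn : (0 : ℝ) ≤ ((k + 3 : ℕ) : ℝ) := by positivity
    have hρp : Measurable fun x => ρ x ^ p := hρ.pow_const p
    refine (lintegral_mono_set hV).trans ((setLIntegral_iUnion_fin_le _ _ _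
      (a := a * (((C / s : ℝ≥0) : ℝ≥0∞) ^ (k + 3) * Ip)) fun i => ?_).trans_eq (by ring))
    rw [ha, Measure.restrict_smul, lintegral_smul_measure]
    have := setLIntegral_comp_hausdorffMeasure_le hf (hlow i) hn hρp
    rw [ENNReal.rpow_natCast] at this
    exact mul_le_mul_right this (a : ℝ≥0∞)
  have h5 : volume K₀ ≤ B * Ip ^ (1 / p) := by
    have hs0 : (s : ℝ≥0) ≠ 0 := hs.ne'
    calc volume K₀ ≤ N * ((C * s : ℝ≥0) : ℝ≥0∞) ^ (k + 1) *
          (((N * a : ℝ≥0∞) * ((C / s : ℝ≥0) : ℝ≥0∞) ^ (k + 3) * Ip) ^ (1 / p) *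
            volume Q ^ (1 / q)) := by
          refine h2.trans ?_
          gcongr
          refine h3.trans ?_
          gcongr
      _ = N * (((C * s : ℝ≥0) : ℝ≥0∞) ^ (k + 1) * ((C / s : ℝ≥0) : ℝ≥0∞) ^ (k + 1)) *
          volume Q ^ (1 / q) * (N * a : ℝ≥0∞) ^ (1 / p) * Ip ^ (1 / p) := by
          have h1p : (0 : ℝ) ≤ 1 / p := by positivity
          rw [ENNReal.mul_rpow_of_nonneg _ _ h1p, ENNReal.mul_rpow_of_nonneg _ _ h1p,
            ← ENNReal.rpow_natCast _ (k + 3), ← ENNReal.rpow_mul]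
          have : ((k + 3 : ℕ) : ℝ) * (1 / p) = ((k + 1 : ℕ) : ℝ) := by
            rw [hp]; field_simp
          rw [this, ENNReal.rpow_natCast]
          ring
      _ = B * Ip ^ (1 / p) := by
          have : ((C * s : ℝ≥0) : ℝ≥0∞) ^ (k + 1) * ((C / s : ℝ≥0) : ℝ≥0∞) ^ (k + 1) =
              (C : ℝ≥0∞) ^ (k + 1) * (C : ℝ≥0∞) ^ (k + 1) := by
            norm_cast
            rw [← mul_pow, ← mul_pow]
            congr 1
            field_simp
          rw [this, hB]
          ring
  have h6 : volume K₀ / (B + 1) ≤ Ip ^ (1 / p) := by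
    refine ENNReal.div_le_of_le_mul ?_
    rw [mul_comm]
    exact h5.trans (by gcongr; exact le_self_add)
  calc (volume K₀ / (B + 1)) ^ p ≤ (Ip ^ (1 / p)) ^ p := by gcongr
    _ = Ip := by rw [← ENNReal.rpow_mul, one_div_mul_cancel hp0.ne', ENNReal.rpow_one]

/-! ### Riemannian distances and smooth maps -/

section Riemannian

-- the norm of the tangent spaces of the model space, in which the derivatives of charts are measured
attribute [local instance] normedAddCommGroupTangentSpaceVectorSpace
attribute [local instance] normedSpaceTangentSpaceVectorSpace

variable {E : Type*} [NormedAddCommGroup E] [NormedSpace ℝ E]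
  {H : Type*} [TopologicalSpace H] (I : ModelWithCorners ℝ E H)
  {M : Type*} [TopologicalSpace M] [ChartedSpace H M]
  [Bundle.RiemannianBundle (fun x : M => TangentSpace I x)]
  [IsManifold I 1 M] [IsContinuousRiemannianBundle E (fun x : M => TangentSpace I x)]

/-- Two points near `x` are joined by the preimage of a segment in the chart, so that their Riemannian
distance is at most a multiple of their distance in the chart. -/
theorem exists_riemannianEDist_le_edist_extChartAt (x : M) :
    ∃ C : ℝ≥0, ∃ s ∈ 𝓝 x, ∀ a ∈ s, ∀ b ∈ s,
      riemannianEDist I a b ≤ C * edist (extChartAt I x a) (extChartAt I x b) := by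
  rcases eventually_enorm_mfderivWithin_symm_extChartAt_lt I x with ⟨C, C_pos, hC⟩
  obtain ⟨P, hPx, hPt, hP⟩ : ∃ P ∈ 𝓝[range I] (extChartAt I x x), P ⊆ (extChartAt I x).target ∧
      ∀ y ∈ P, ∀ v : TangentSpace 𝓘(ℝ, E) y,
        ‖mfderiv[range I] (extChartAt I x).symm y v‖ₑ ≤ C * ‖v‖ₑ := by
    refine ⟨_, Filter.inter_mem (extChartAt_target_mem_nhdsWithin x) hC, inter_subset_left, ?_⟩
    intro y hy v
    apply (ContinuousLinearMap.le_opENorm _ _).trans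
    gcongr
    exact hy.2.le
  obtain ⟨r, r_pos, hr⟩ := Metric.mem_nhdsWithin_iff.1 hPx
  have A : (extChartAt I x) ⁻¹' (Metric.ball (extChartAt I x x) r ∩ range I) ∈ 𝓝 x := by
    apply extChartAt_preimage_mem_nhds_of_mem_nhdsWithin (by simp)
    rw [inter_comm]
    exact inter_mem_nhdsWithin _ (Metric.ball_mem_nhds _ r_pos)
  refine ⟨C, _, Filter.inter_mem A (chart_source_mem_nhds H x), ?_⟩
  rintro a ⟨ha, h'a⟩ b ⟨hb, h'b⟩
  let η := ContinuousAffineMap.lineMap (R := ℝ) (extChartAt I x a) (extChartAt I x b)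
  set γ := (extChartAt I x).symm ∘ η
  have hη : Icc 0 1 ⊆ ⇑η ⁻¹' P := by
    simp only [← image_subset_iff, ContinuousAffineMap.coe_lineMap_eq,
     ← segment_eq_image_lineMap, η]
    exact Subset.trans (((convex_ball _ _).inter I.convex_range).segment_subset ha hb) hr
  have hηt : Icc 0 1 ⊆ ⇑η ⁻¹' (extChartAt I x).target := hη.trans (preimage_mono hPt)
  have η_smooth : CMDiff[Icc 0 1] 1 η := by
    apply ContMDiff.contMDiffOn
    rw [contMDiff_iff_contDiff]
    exact ContinuousAffineMap.contDiff _
  have : riemannianEDist I a b ≤ pathELength I γ 0 1 := by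
    apply riemannianEDist_le_pathELength _ _ _ zero_le_one
    · exact (contMDiffOn_extChartAt_symm x).comp η_smooth hηt
    · simp [γ, η, ContinuousAffineMap.coe_lineMap_eq, h'a]
    · simp [γ, η, ContinuousAffineMap.coe_lineMap_eq, h'b]
  apply this.trans
  rw [← lintegral_fderiv_lineMap_eq_edist, pathELength_eq_lintegral_mfderivWithin_Icc,
    ← lintegral_const_mul' _ _ ENNReal.coe_ne_top]
  apply setLIntegral_mono' measurableSet_Icc (fun t ht ↦ ?_)
  have : mfderiv[Icc 0 1] γ t =
      (mfderiv[range I] (extChartAt I x).symm (η t)) ∘L (mfderiv[Icc 0 1] η t) := by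
    apply mfderivWithin_comp
    · exact mdifferentiableWithinAt_extChartAt_symm (hηt ht)
    · exact η_smooth.mdifferentiableOn one_ne_zero t ht
    · exact hηt.trans (preimage_mono (extChartAt_target_subset_range x))
    · rw [uniqueMDiffWithinAt_iff_uniqueDiffWithinAt]
      exact uniqueDiffOn_Icc zero_lt_one t ht
  have : mfderiv[Icc 0 1] γ t 1 =
      (mfderiv[range I] (extChartAt I x).symm (η t)) (mfderiv[Icc 0 1] η t 1) := congr($this 1)
  rw [this]
  refine (hP _ (hη ht) _).trans ?_
  gcongr
  simp only [mfderivWithin_eq_fderivWithin]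
  exact le_of_eq rfl

/-- A path between two points near `x` that is almost as short as possible stays in a neighbourhood of
`x` where the derivative of the chart is bounded, so that the chart is Lipschitz near `x` for the
Riemannian distance. -/
theorem exists_edist_extChartAt_le_riemannianEDist [RegularSpace M] (x : M) :
    ∃ C : ℝ≥0, ∃ s ∈ 𝓝 x, ∀ a ∈ s, ∀ b ∈ s,
      edist (extChartAt I x a) (extChartAt I x b) ≤ C * riemannianEDist I a b := by
  rcases eventually_enorm_mfderiv_extChartAt_lt I x with ⟨C, C_pos, hC⟩
  obtain ⟨c, c_pos, hc⟩ := setOfPred_riemannianEDist_lt_subset_nhds I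
    (Filter.inter_mem hC (chart_source_mem_nhds H x))
  have h3 : (0 : ℝ≥0∞) < ((c / 3 : ℝ≥0) : ℝ≥0∞) := by
    exact_mod_cast (by positivity : 0 < c / 3)
  have hsum : ((c / 3 : ℝ≥0) : ℝ≥0∞) + ((c / 3 : ℝ≥0) : ℝ≥0∞) + ((c / 3 : ℝ≥0) : ℝ≥0∞) = c := by
    norm_cast
    rw [← NNReal.coe_inj]; push_cast; ring
  refine ⟨C, _, eventually_riemannianEDist_lt I x h3, fun a ha b hb => ?_⟩
  have ha : riemannianEDist I x a < (c / 3 : ℝ≥0) := ha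
  have hb : riemannianEDist I x b < (c / 3 : ℝ≥0) := hb
  have hab : riemannianEDist I a b < ((c / 3 : ℝ≥0) : ℝ≥0∞) + (c / 3 : ℝ≥0) := by
    refine riemannianEDist_triangle.trans_lt (ENNReal.add_lt_add ?_ hb)
    rwa [riemannianEDist_comm]
  have hr : ∀ r, riemannianEDist I a b < r → r < ((c / 3 : ℝ≥0) : ℝ≥0∞) + (c / 3 : ℝ≥0) →
      edist (extChartAt I x a) (extChartAt I x b) ≤ C * r := by
    intro r hr hrc
    rcases exists_lt_locally_constant_of_riemannianEDist_lt hr zero_lt_one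
      with ⟨γ, hγa, hγb, γ_smooth, hγ, -⟩
    -- the path is too short to leave the ball of radius `c` around `x`
    have hstay : ∀ t ∈ Icc (0 : ℝ) 1, γ t ∈ {y | riemannianEDist I x y < c} := by
      intro t ht
      have h1 : riemannianEDist I a (γ t) ≤ pathELength I γ 0 t :=
        riemannianEDist_le_pathELength γ_smooth.contMDiffOn hγa rfl ht.1
      have h2 : pathELength I γ 0 t ≤ pathELength I γ 0 1 := pathELength_mono le_rfl ht.2
      show riemannianEDist I x (γ t) < c
      rw [← hsum, add_assoc]
      exact riemannianEDist_triangle.trans_lt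
        (ENNReal.add_lt_add ha ((h1.trans h2).trans_lt (hγ.trans hrc)))
    let γ' := extChartAt I x ∘ γ
    have hC' : CMDiff[Icc 0 1] 1 γ' :=
      contMDiffOn_extChartAt.comp (I' := I) (t := (chartAt H x).source)
        γ_smooth.contMDiffOn (fun t' ht' ↦ (hc (hstay t' ht')).2)
    calc edist (extChartAt I x a) (extChartAt I x b)
      _ = ‖γ' 1 - γ' 0‖ₑ := by
        rw [edist_comm, edist_eq_enorm_sub]
        simp [γ', hγa, hγb]
      _ ≤ ∫⁻ t' in Icc 0 1, ‖derivWithin γ' (Icc 0 1) t'‖ₑ := by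
        apply enorm_sub_le_lintegral_derivWithin_Icc_of_contDiffOn_Icc _ zero_le_one
        rwa [← contMDiffOn_iff_contDiffOn]
      _ = ∫⁻ t' in Icc 0 1, ‖mfderiv[Icc 0 1] γ' t' 1‖ₑ := by
        simp_rw [← fderivWithin_derivWithin, mfderivWithin_eq_fderivWithin]
        rfl
      _ ≤ ∫⁻ t' in Icc 0 1, C * ‖mfderiv[Icc 0 1] γ t' 1‖ₑ := by
        apply setLIntegral_mono' measurableSet_Icc (fun t' ht' ↦ ?_)
        have : mfderiv[Icc 0 1] γ' t' =
            (mfderiv% (extChartAt I x) (γ t')) ∘L (mfderiv[Icc 0 1] γ t') := by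
          apply mfderiv_comp_mfderivWithin
          · exact mdifferentiableAt_extChartAt (hc (hstay t' ht')).2
          · exact (γ_smooth.mdifferentiable one_ne_zero).mdifferentiableOn _ ht'
          · rw [uniqueMDiffWithinAt_iff_uniqueDiffWithinAt]
            exact uniqueDiffOn_Icc zero_lt_one _ ht'
        have : mfderiv[Icc 0 1] γ' t' 1 =
            (mfderiv% (extChartAt I x) (γ t')) (mfderiv[Icc 0 1] γ t' 1) :=
          congr($this 1)
        rw [this]
        apply (ContinuousLinearMap.le_opENorm _ _).trans
        gcongr
        exact (hc (hstay t' ht')).1.le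
      _ = C * pathELength I γ 0 1 := by
        rw [lintegral_const_mul' _ _ ENNReal.coe_ne_top,
            pathELength_eq_lintegral_mfderivWithin_Icc]
      _ ≤ C * r := by gcongr
  -- let `r` decrease to the Riemannian distance
  have hC0 : (C : ℝ≥0∞) ≠ 0 := by exact_mod_cast C_pos.ne'
  rw [mul_comm, ← ENNReal.div_le_iff_le_mul (Or.inl hC0) (Or.inl ENNReal.coe_ne_top)] 
  refine le_of_forall_gt_imp_ge_of_dense fun r h1 => ?_
  rcases lt_or_ge r (((c / 3 : ℝ≥0) : ℝ≥0∞) + (c / 3 : ℝ≥0)) with h | h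
  · exact ENNReal.div_le_of_le_mul' (hr r h1 h)
  · obtain ⟨r', h1', h2'⟩ := exists_between hab
    exact (ENNReal.div_le_of_le_mul' (hr r' h1' h2')).trans (h2'.le.trans h)

/-- If `G ∘ F` is bilipschitz near `x` for smooth maps `F : V → M` and `G : M → W`, then `F` is bilipschitz
near `x` for the Riemannian distance of `M`. -/
theorem exists_bilipschitz_riemannianEDist {V W : Type*} [NormedAddCommGroup V] [NormedSpace ℝ V]
    [NormedAddCommGroup W] [NormedSpace ℝ W] [I.Boundaryless] [RegularSpace M] {F : V → M} {G : M → W} {x : V}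
    (hF : ContMDiffAt 𝓘(ℝ, V) I 1 F x) (hG : ContMDiffAt I 𝓘(ℝ, W) 1 G (F x))
    (hGF : ∃ K : ℝ≥0, ∃ s ∈ 𝓝 x, ∀ a ∈ s, ∀ b ∈ s, edist a b ≤ K * edist (G (F a)) (G (F b))) :
    ∃ C : ℝ≥0, ∃ s ∈ 𝓝 x, ∀ a ∈ s, ∀ b ∈ s, riemannianEDist I (F a) (F b) ≤ C * edist a b ∧
      edist a b ≤ C * riemannianEDist I (F a) (F b) := by
  obtain ⟨K, s, hs, hK⟩ := hGF
  obtain ⟨C₁, s₁, hs₁, hC₁⟩ := exists_riemannianEDist_le_edist_extChartAt I (F x)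
  obtain ⟨C₂, s₂, hs₂, hC₂⟩ := exists_edist_extChartAt_le_riemannianEDist I (F x)
  have hχF : ContDiffAt ℝ 1 (extChartAt I (F x) ∘ F) x := by
    rw [← contMDiffAt_iff_contDiffAt]
    exact contMDiffAt_extChartAt.comp x hF
  have hGχ : ContDiffAt ℝ 1 (G ∘ (extChartAt I (F x)).symm) (extChartAt I (F x) (F x)) := by
    have := (contMDiffAt_iff.1 hG).2
    rwa [I.range_eq_univ, contDiffWithinAt_univ] at this
  obtain ⟨L₁, t₁, ht₁, hL₁⟩ := hχF.exists_lipschitzOnWith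
  obtain ⟨L₂, t₂, ht₂, hL₂⟩ := hGχ.exists_lipschitzOnWith
  have hFc := hF.continuousAt
  refine ⟨C₁ * L₁ + K * L₂ * C₂, s ∩ t₁ ∩ F ⁻¹' (s₁ ∩ s₂ ∩ (extChartAt I (F x)).source) ∩
    (extChartAt I (F x) ∘ F) ⁻¹' t₂, ?_, ?_⟩
  · refine Filter.inter_mem (Filter.inter_mem (Filter.inter_mem hs ht₁) (hFc.preimage_mem_nhds
      (Filter.inter_mem (Filter.inter_mem hs₁ hs₂) (extChartAt_source_mem_nhds _)))) ?_
    exact hχF.continuousAt.preimage_mem_nhds ht₂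
  · rintro a ⟨⟨⟨ha, ha₁⟩, ⟨hFa₁, hFa₂⟩, hFa⟩, ha₂⟩ b ⟨⟨⟨hb, hb₁⟩, ⟨hFb₁, hFb₂⟩, hFb⟩, hb₂⟩
    constructor
    · calc riemannianEDist I (F a) (F b)
          ≤ C₁ * (L₁ * edist a b) := (hC₁ _ hFa₁ _ hFb₁).trans (by gcongr; exact hL₁ ha₁ hb₁)
        _ ≤ _ := by
          rw [← mul_assoc]
          gcongr
          push_cast
          exact le_self_add
    · have h1 := hL₂ ha₂ hb₂
      simp only [Function.comp_apply, (extChartAt I (F x)).left_inv hFa,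
        (extChartAt I (F x)).left_inv hFb] at h1
      calc edist a b ≤ K * (L₂ * (C₂ * riemannianEDist I (F a) (F b))) := by
            refine (hK a ha b hb).trans ?_
            gcongr
            refine h1.trans ?_
            gcongr
            exact hC₂ _ hFa₂ _ hFb₂
        _ ≤ _ := by
          rw [← mul_assoc, ← mul_assoc]
          gcongr
          push_cast
          exact le_add_self

end Riemannian

/-! ### Core tori of the Blankinship rings -/

theorem one_add_conj_mul_ne_zero {z u : ℂ} (hz : ‖z‖ < 1) (hu : ‖u‖ ≤ 1) :
    1 + (starRingEnd ℂ) z * u ≠ 0 := by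
  intro h
  have h1 : (starRingEnd ℂ) z * u = -1 := by linear_combination h
  have h2 : ‖z‖ * ‖u‖ = 1 := by
    rw [← Complex.norm_conj z, ← norm_mul, h1, norm_neg, norm_one]
  nlinarith [norm_nonneg z, norm_nonneg u]

/-- The Möbius transformation of the closed unit disc that sends `0` to `z`. -/
def moebius (z : ℂ) (hz : ‖z‖ < 1) (u : Disc) : Disc :=
  ⟨(u + z) / (1 + (starRingEnd ℂ) z * u), by
    have hu : ‖(u : ℂ)‖ ≤ 1 := mem_closedBall_zero_iff.1 u.2
    rw [mem_closedBall_zero_iff, norm_div,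
      div_le_one (norm_pos_iff.2 (one_add_conj_mul_ne_zero hz hu))]
    refine le_of_sq_le_sq ?_ (norm_nonneg _)
    have hz2 : Complex.normSq z ≤ 1 := by
      rw [Complex.normSq_eq_norm_sq]; nlinarith [norm_nonneg z]
    have hu2 : Complex.normSq (u : ℂ) ≤ 1 := by
      rw [Complex.normSq_eq_norm_sq]; nlinarith [norm_nonneg (u : ℂ)]
    rw [← Complex.normSq_eq_norm_sq, ← Complex.normSq_eq_norm_sq]
    have : Complex.normSq (1 + (starRingEnd ℂ) z * u) - Complex.normSq (u + z) =
        (1 - Complex.normSq z) * (1 - Complex.normSq (u : ℂ)) := by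
      simp only [Complex.normSq_apply, Complex.add_re, Complex.add_im, Complex.mul_re,
        Complex.mul_im, Complex.conj_re, Complex.conj_im, Complex.one_re, Complex.one_im]
      ring
    nlinarith [mul_nonneg (sub_nonneg.2 hz2) (sub_nonneg.2 hu2)]⟩

theorem moebius_neg_moebius (z : ℂ) (hz : ‖z‖ < 1) (u : Disc) :
    moebius (-z) (by rwa [norm_neg]) (moebius z hz u) = u := by
  have hu : ‖(u : ℂ)‖ ≤ 1 := mem_closedBall_zero_iff.1 u.2
  have hv : ‖(moebius z hz u : ℂ)‖ ≤ 1 := mem_closedBall_zero_iff.1 (moebius z hz u).2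
  have h1 := one_add_conj_mul_ne_zero hz hu
  have h2 := one_add_conj_mul_ne_zero (z := -z) (by rwa [norm_neg]) hv
  apply Subtype.ext
  simp only [moebius] at h2 ⊢
  rw [div_eq_iff h2]
  simp only [map_neg]
  generalize (starRingEnd ℂ) z = c at h1
  obtain ⟨D, hD⟩ : ∃ D, D = 1 + c * (u : ℂ) := ⟨_, rfl⟩
  rw [← hD] at h1 ⊢
  field_simp
  rw [hD]
  ring

theorem continuous_moebius (z : ℂ) (hz : ‖z‖ < 1) : Continuous (moebius z hz) := by
  refine Continuous.subtype_mk ?_ _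
  refine Continuous.div (by fun_prop) (by fun_prop) fun u => ?_
  exact one_add_conj_mul_ne_zero hz (mem_closedBall_zero_iff.1 u.2)

/-- The Möbius transformation that sends `0` to `z` as a homeomorphism of the closed disc. -/
def moebiusHomeomorph (z : ℂ) (hz : ‖z‖ < 1) : Disc ≃ₜ Disc where
  toFun := moebius z hz
  invFun := moebius (-z) (by rwa [norm_neg])
  left_inv := moebius_neg_moebius z hz
  right_inv u := by
    have := moebius_neg_moebius (-z) (by rwa [norm_neg]) u
    simpa only [neg_neg] using this
  continuous_toFun := continuous_moebius _ _
  continuous_invFun := continuous_moebius _ _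

/-- Every torus over an interior point `z` of the disc is a core torus: the Möbius transformations act
transitively on the interior. -/
theorem isCoreTorus_image_fiber {k : ℕ} {X : Type*} [TopologicalSpace X] [T2Space X]
    {f : Tube k → X} (hf : Continuous f) (hinj : Function.Injective f) {z : ℂ} (hz : ‖z‖ < 1) :
    IsCoreTorus (k := k) (range f) (f '' {p | (p.1 : ℂ) = z}) := by
  have : CompactSpace Disc := isCompact_iff_compactSpace.1 (isCompact_closedBall _ _)
  have he : IsEmbedding f := (hf.isClosedEmbedding hinj).isEmbedding
  let m : Tube k ≃ₜ Tube k := (moebiusHomeomorph z hz).prodCongr (Homeomorph.refl _)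
  refine ⟨m.trans he.toHomeomorph, ?_⟩
  have h0 : {p : Tube k | (p.1 : ℂ) = z} = m '' {p | (p.1 : ℂ) = 0} := by
    have hm0 : ∀ u : Disc, (u : ℂ) = 0 → (moebius z hz u : ℂ) = z := by
      intro u hu; simp [moebius, hu]
    ext p
    constructor
    · intro hp
      refine ⟨m.symm p, ?_, m.apply_symm_apply p⟩
      change ((moebius (-z) (by rwa [norm_neg]) p.1 : Disc) : ℂ) = 0
      have hp : (p.1 : ℂ) = z := hp
      simp [moebius, hp]
    · rintro ⟨q, hq, rfl⟩
      exact hm0 q.1 hq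
  rw [h0, image_image]
  rfl

theorem SolidTorus.coords_injective : Function.Injective SolidTorus.coords := fun _ _ h =>
  Prod.ext (Subtype.ext (congrArg Prod.fst h)) (Circle.ext (congrArg Prod.snd h))

theorem Tube.coords_injective {k : ℕ} : Function.Injective (Tube.coords (k := k)) := fun _ _ h =>
  Prod.ext (Subtype.ext (congrArg Prod.fst h))
    (funext fun j => Circle.ext (congrFun (congrArg Prod.snd h) j))

theorem IsSmoothEmbedding.injective {X Y E F : Type*} [NormedAddCommGroup E] [NormedSpace ℝ E]
    [NormedAddCommGroup F] [NormedSpace ℝ F] {a : X → E} {b : Y → F} {f : X → Y}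
    (hf : IsSmoothEmbedding a b f) (ha : Function.Injective a) : Function.Injective f := by
  obtain ⟨-, h, -, hh⟩ := hf
  intro x y hxy
  apply ha
  rw [← hh x, ← hh y, hxy]

theorem cyc_injective {k : ℕ} : Function.Injective (cyc (k := k)) := by
  intro x y h
  funext j
  have := congrFun h (j + 1)
  simpa [cyc] using this

namespace BingPackage

variable (P : BingPackage) (k : ℕ)

theorem bb_injective (i : Fin 2) : Function.Injective (P.bb k i) := by
  intro p q h
  have h1 := congrArg Prod.fst h
  have h2 := congrArg Prod.snd h
  simp only [bb] at h1 h2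
  have h3 : (P.φ i (p.1, cyc p.2 0)).2 = (P.φ i (q.1, cyc q.2 0)).2 := by
    simpa using congrFun h2 0
  have h4 := (P.smoothEmbedding i).injective SolidTorus.coords_injective (Prod.ext h1 h3)
  refine Prod.ext ((Prod.ext_iff.1 h4).1) (cyc_injective (funext fun j => ?_))
  by_cases hj : j = 0
  · rw [hj]; exact (Prod.ext_iff.1 h4).2
  · simpa [hj] using congrFun h2 j

theorem word_injective (w : List (Fin 2)) : Function.Injective (P.word k w) := by
  induction w with
  | nil => exact Function.injective_id
  | cons i w ih => exact (P.bb_injective k i).comp ih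

theorem word_append_singleton (w : List (Fin 2)) (i : Fin 2) :
    P.word k (w ++ [i]) = P.word k w ∘ P.bb k i := by
  induction w with
  | nil => rfl
  | cons j w ih => simp only [List.cons_append, word, ih]; rfl

/-- The images of the two embeddings stay away from the boundary of the tube. -/
theorem exists_norm_bb_le : ∃ r : ℝ, 0 ≤ r ∧ r < 1 ∧ ∀ i p, ‖((P.bb k i p).1 : ℂ)‖ ≤ r := by
  have : CompactSpace Disc := isCompact_iff_compactSpace.1 (isCompact_closedBall _ _)
  have h : ∀ i, ∃ r : ℝ, r < 1 ∧ ∀ p, ‖((P.bb k i p).1 : ℂ)‖ ≤ r := by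
    intro i
    have hc : Continuous fun p : Tube k => ‖((P.bb k i p).1 : ℂ)‖ :=
      (continuous_subtype_val.comp (continuous_fst.comp (P.continuous_bb k i))).norm
    have hne : Nonempty (Tube k) := ⟨(⟨0, by simp⟩, 1)⟩
    obtain ⟨p₀, hp₀⟩ := hc.exists_forall_ge_of_hasCompactSupport
      (HasCompactSupport.of_compactSpace _)
    exact ⟨_, P.mapsTo_interior i _, hp₀⟩
  obtain ⟨r₀, h₀, h₀'⟩ := h 0
  obtain ⟨r₁, h₁, h₁'⟩ := h 1
  refine ⟨max r₀ r₁, ?_, max_lt h₀ h₁, ?_⟩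
  · exact (norm_nonneg _).trans ((h₀' (⟨0, by simp⟩, 1)).trans (le_max_left _ _))
  · intro i p
    fin_cases i
    · exact (h₀' p).trans (le_max_left _ _)
    · exact (h₁' p).trans (le_max_right _ _)

variable {P k}

theorem notMem_singularSet {r : ℝ} (hr : ∀ i p, ‖((P.bb k i p).1 : ℂ)‖ ≤ r) {p : Tube k}
    (hp : r < ‖(p.1 : ℂ)‖) : p ∉ P.singularSet k := by
  intro h
  obtain ⟨w, hw, q, rfl⟩ := mem_iUnion₂.1 (mem_iInter.1 h 1)
  obtain ⟨i, rfl⟩ := List.length_eq_one_iff.1 hw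
  exact absurd (hr i q) (not_le.2 hp)

theorem image_fiber_mem_coreTori {r : ℝ} (hr : ∀ i p, ‖((P.bb k i p).1 : ℂ)‖ ≤ r) {z : ℂ}
    (hz : r < ‖z‖) (hz1 : ‖z‖ < 1) (w : List (Fin 2)) :
    P.word k w '' {p | (p.1 : ℂ) = z} ∈ P.coreTori k w := by
  refine ⟨isCoreTorus_image_fiber (P.continuous_word k w) (P.word_injective k w) hz1, ?_⟩
  rintro _ ⟨p, hp, rfl⟩
  have hp : (p.1 : ℂ) = z := hp
  have hnot : ∀ i, P.word k w p ∉ P.ring k (w ++ [i]) := by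
    rintro i ⟨q, hq⟩
    rw [word_append_singleton] at hq
    have := P.word_injective k w hq
    have h2 := hr i q
    rw [this, hp] at h2
    exact absurd h2 (not_le.2 hz)
  exact ⟨mem_range_self p, fun h => h.elim (hnot 0) (hnot 1)⟩

end BingPackage

/-! ### A parametrisation of a part of the tube -/

/-- The map `(z, x) ↦ (β(z), e^{ix})` from `ℂ × ℝⁿ⁻²` to the tube, where `β` is the standard diffeomorphism
from `ℂ` onto the disc with centre `c` and radius `δ`. It is defined on a whole vector space, so that
smoothness of maps that are composed with it does not involve the boundary of the tube. -/
def tubeParam (k : ℕ) {c : ℂ} {δ : ℝ} (hδ : 0 < δ) (h : Metric.ball c δ ⊆ Metric.closedBall 0 1)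
    (v : ℂ × (Fin (k + 1) → ℝ)) : Tube k :=
  (⟨OpenPartialHomeomorph.univBall c δ v.1, h <| by
    rw [← OpenPartialHomeomorph.univBall_target c hδ]
    exact (OpenPartialHomeomorph.univBall c δ).map_source (by simp)⟩, fun j => Circle.exp (v.2 j))

section Param

variable {k : ℕ} {c : ℂ} {δ : ℝ} (hδ : 0 < δ) (h : Metric.ball c δ ⊆ Metric.closedBall 0 1)

theorem coords_tubeParam (v : ℂ × (Fin (k + 1) → ℝ)) : (tubeParam k hδ h v).coords =
    (OpenPartialHomeomorph.univBall c δ v.1, fun j => Complex.exp (v.2 j * Complex.I)) := rfl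

theorem tubeParam_fst_mem_ball (v : ℂ × (Fin (k + 1) → ℝ)) :
    ((tubeParam k hδ h v).1 : ℂ) ∈ Metric.ball c δ := by
  rw [← OpenPartialHomeomorph.univBall_target c hδ]
  exact (OpenPartialHomeomorph.univBall c δ).map_source (by simp)

theorem contDiff_coords_tubeParam :
    ContDiff ℝ ∞ fun v : ℂ × (Fin (k + 1) → ℝ) => (tubeParam k hδ h v).coords := by
  simp only [coords_tubeParam]
  refine ContDiff.prodMk (OpenPartialHomeomorph.contDiff_univBall.comp contDiff_fst)
    (contDiff_pi.2 fun j => ?_)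
  refine Complex.contDiff_exp.comp (ContDiff.mul ?_ contDiff_const)
  exact Complex.ofRealCLM.contDiff.comp ((contDiff_apply ℝ ℝ j).comp contDiff_snd)

theorem continuous_tubeParam : Continuous (tubeParam k hδ h) := by
  unfold tubeParam
  have := OpenPartialHomeomorph.continuous_univBall c δ
  fun_prop

theorem edist_le_two_mul_edist_exp {x y : ℝ} (hxy : |x - y| ≤ Real.pi) :
    edist x y ≤ 2 * edist (Complex.exp (x * Complex.I)) (Complex.exp (y * Complex.I)) := by
  have h1 : ‖Complex.exp (x * Complex.I) - Complex.exp (y * Complex.I)‖ =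
      2 * |Real.sin ((x - y) / 2)| := by
    have : Complex.exp (x * Complex.I) - Complex.exp (y * Complex.I) =
        Complex.exp (y * Complex.I) * (Complex.exp (Complex.I * (x - y : ℝ)) - 1) := by
      rw [mul_sub, ← Complex.exp_add, mul_one]
      congr 2
      push_cast
      ring
    rw [this, norm_mul, Complex.norm_exp_ofReal_mul_I, one_mul,
      Complex.norm_exp_I_mul_ofReal_sub_one, norm_mul, Real.norm_eq_abs, Real.norm_eq_abs, abs_two]
  have h2 := Real.mul_abs_le_abs_sin (x := (x - y) / 2) (by
    rw [abs_div, abs_two]; linarith)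
  have h3 : |x - y| ≤ 2 * (2 * |Real.sin ((x - y) / 2)|) := by
    rw [abs_div, abs_two, div_mul_div_comm, div_le_iff₀ (by positivity)] at h2
    nlinarith [Real.pi_lt_four, Real.pi_pos, abs_nonneg (Real.sin ((x - y) / 2))]
  rw [edist_dist, edist_dist, Real.dist_eq, dist_eq_norm, h1, ← ENNReal.ofReal_ofNat 2,
    ← ENNReal.ofReal_mul (by norm_num)]
  exact ENNReal.ofReal_le_ofReal h3

theorem exists_edist_le_edist_coords_tubeParam (v : ℂ × (Fin (k + 1) → ℝ)) :
    ∃ K : ℝ≥0, ∃ s ∈ 𝓝 v, ∀ a ∈ s, ∀ b ∈ s,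
      edist a b ≤ K * edist (tubeParam k hδ h a).coords (tubeParam k hδ h b).coords := by
  set β := OpenPartialHomeomorph.univBall c δ with hβ
  have hβs : ∀ z, β.symm (β z) = z := fun z => β.left_inv (by simp [hβ])
  have hsymm : ContDiffAt ℝ 1 β.symm (β v.1) :=
    OpenPartialHomeomorph.contDiffOn_univBall_symm.contDiffAt
      (Metric.isOpen_ball.mem_nhds (tubeParam_fst_mem_ball hδ h v))
  obtain ⟨L, t, ht, hL⟩ := hsymm.exists_lipschitzOnWith
  have hβc : Continuous β := OpenPartialHomeomorph.continuous_univBall c δ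
  refine ⟨L + 2, (fun a => β a.1) ⁻¹' t ∩ Metric.ball v 1,
    Filter.inter_mem ((hβc.comp continuous_fst).continuousAt.preimage_mem_nhds ht)
      (Metric.ball_mem_nhds _ one_pos), ?_⟩
  rintro a ⟨ha, ha'⟩ b ⟨hb, hb'⟩
  rw [coords_tubeParam, coords_tubeParam]
  simp only [Prod.edist_eq]
  refine max_le ?_ ((edist_pi_le_iff).2 fun j => ?_)
  · have := hL ha hb
    rw [hβs, hβs] at this
    refine this.trans ?_
    push_cast
    gcongr
    · exact le_self_add
    · exact le_max_left _ _
  · have hab : |a.2 j - b.2 j| ≤ Real.pi := by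
      have h1 : dist a b < 2 := by
        have := dist_triangle_right a b v
        linarith [Metric.mem_ball.1 ha', Metric.mem_ball.1 hb']
      have h2 : dist (a.2 j) (b.2 j) ≤ dist a b :=
        (dist_le_pi_dist a.2 b.2 j).trans (le_max_right _ _)
      rw [← Real.dist_eq]
      linarith [Real.pi_gt_three]
    refine (edist_le_two_mul_edist_exp hab).trans ?_
    push_cast
    gcongr
    · exact le_add_self
    · exact (edist_le_pi_edist (fun j => Complex.exp (a.2 j * Complex.I))
        (fun j => Complex.exp (b.2 j * Complex.I)) j).trans (le_max_right _ _)

end Param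

/-! ### The Semmes metric in the parametrisation -/

theorem Placement.injective_ϑ {k : ℕ} (A : Placement k) : Function.Injective A.ϑ :=
  A.smoothEmbedding.injective Tube.coords_injective

theorem Placement.continuous_ϑ {k : ℕ} (A : Placement k) : Continuous A.ϑ := by
  obtain ⟨g, hg, h⟩ := A.smoothEmbedding.1
  refine Topology.IsInducing.subtypeVal.continuous_iff.2 ?_
  have : Subtype.val ∘ A.ϑ = fun p => g p.coords := funext fun p => (h p).symm
  rw [this]
  refine hg.continuous.comp ?_
  unfold Tube.coords
  fun_prop

/-- Away from the singular set, `ρ ∘ ϑ` is a smooth embedding into the Riemannian manifold `𝕊ⁿ ∖ E`: the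
inverse of `ρ` followed by the smooth left inverse of `ϑ` is a smooth left inverse. Hence the parametrised
tube with its Euclidean metric is locally bilipschitz to its image with the metric `d`. -/
theorem SemmesData.exists_bilipschitz_tubeParam {k : ℕ} (S : SemmesData k) {c : ℂ} {δ : ℝ}
    (hδ : 0 < δ) (h : Metric.ball c δ ⊆ Metric.closedBall 0 1)
    (hsing : ∀ v, tubeParam k hδ h v ∉ S.A.P.singularSet k) (v : ℂ × (Fin (k + 1) → ℝ)) :
    ∃ C : ℝ≥0, ∃ s ∈ 𝓝 v, ∀ a ∈ s, ∀ b ∈ s,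
      ENNReal.ofReal (S.D.d (S.R.ρ (S.A.ϑ (tubeParam k hδ h a)))
        (S.R.ρ (S.A.ϑ (tubeParam k hδ h b)))) ≤ C * edist a b ∧
      edist a b ≤ C * ENNReal.ofReal (S.D.d (S.R.ρ (S.A.ϑ (tubeParam k hδ h a)))
        (S.R.ρ (S.A.ϑ (tubeParam k hδ h b)))) := by
  set e := tubeParam k hδ h with he
  have hsing' : ∀ a, S.A.ϑ (e a) ∈ S.A.singᶜ := by
    rintro a ⟨p, hp, hpa⟩
    rw [S.A.injective_ϑ hpa] at hp
    exact hsing a hp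
  have hmem : ∀ a, S.R.ρ (S.A.ϑ (e a)) ∈ S.R.regular := fun a => S.R.bijOn.mapsTo (hsing' a)
  obtain ⟨g, hg⟩ := S.almostSmooth
  let : Bundle.RiemannianBundle
      (fun x : S.R.regular => TangentSpace (𝓡 (k + 3)) x) := ⟨g.toRiemannianMetric⟩
  have : IsContinuousRiemannianBundle (EuclideanSpace ℝ (Fin (k + 3)))
      (fun x : S.R.regular => TangentSpace (𝓡 (k + 3)) x) :=
    ⟨⟨g.inner, g.contMDiff.continuous, fun _ _ _ => rfl⟩⟩
  have : Fact (Module.finrank ℝ (EuclideanSpace ℝ (Fin (k + 3 + 1))) = k + 3 + 1) :=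
    ⟨finrank_euclideanSpace_fin⟩
  obtain ⟨⟨g₀, hg₀, hg₀'⟩, h₀, hh₀, hh₀'⟩ := S.A.smoothEmbedding
  obtain ⟨σ, hσ, hσρ⟩ := S.R.contMDiffOn_inv
  let F : ℂ × (Fin (k + 1) → ℝ) → S.R.regular := fun a => ⟨S.R.ρ (S.A.ϑ (e a)), hmem a⟩
  let G : S.R.regular → ℂ × (Fin (k + 1) → ℂ) := fun y => h₀ (σ y)
  have hϑe : ContMDiff 𝓘(ℝ, ℂ × (Fin (k + 1) → ℝ)) (𝓡 (k + 3)) ∞ fun a => S.A.ϑ (e a) := by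
    have h1 : ContMDiff 𝓘(ℝ, ℂ × (Fin (k + 1) → ℝ))
        𝓘(ℝ, EuclideanSpace ℝ (Fin (k + 3 + 1))) ∞ fun a => (S.A.ϑ (e a)).val := by
      have : (fun a => (S.A.ϑ (e a)).val) = fun a => g₀ (e a).coords :=
        funext fun a => (hg₀' _).symm
      rw [this]
      exact (hg₀.comp (contDiff_coords_tubeParam hδ h)).contMDiff
    exact h1.codRestrict_sphere fun a => (S.A.ϑ (e a)).2
  have hF : ContMDiff 𝓘(ℝ, ℂ × (Fin (k + 1) → ℝ)) (𝓡 (k + 3)) ∞ F := by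
    rw [← ContMDiff.subtypeVal_comp_iff]
    exact S.R.contMDiffOn.comp_contMDiff hϑe hsing'
  have hG : ContMDiffAt (𝓡 (k + 3)) 𝓘(ℝ, ℂ × (Fin (k + 1) → ℂ)) ∞ G (F v) := by
    have h1 : ContMDiffAt (𝓡 (k + 3)) (𝓡 (k + 3)) ∞ σ (F v).1 :=
      hσ.contMDiffAt (S.R.regular.isOpen.mem_nhds (F v).2)
    have h2 : ContMDiff (𝓡 (k + 3)) 𝓘(ℝ, ℂ × (Fin (k + 1) → ℂ)) ∞ fun y : Sph k => h₀ y :=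
      hh₀.contMDiff.comp contMDiff_coe_sphere
    exact h2.contMDiffAt.comp _ (contMDiffAt_subtype_iff.2 h1)
  have hGF : ∀ a, G (F a) = (e a).coords := fun a => by
    change h₀ (σ (S.R.ρ (S.A.ϑ (e a)))) = _
    rw [hσρ (hsing' a), hh₀']
  obtain ⟨C, s, hs, hC⟩ := exists_bilipschitz_riemannianEDist (𝓡 (k + 3)) (F := F) (G := G) (x := v)
    ((hF v).of_le (by simp)) (hG.of_le (by simp))
    (by simpa only [hGF] using exists_edist_le_edist_coords_tubeParam hδ h v)
  refine ⟨C, s, hs, fun a ha b hb => ?_⟩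
  have := hC a ha b hb
  have hd : ENNReal.ofReal (S.D.d (S.R.ρ (S.A.ϑ (e a))) (S.R.ρ (S.A.ϑ (e b)))) =
      riemannianEDist (𝓡 (k + 3)) (F a) (F b) := hg (F a) (F b)
  rwa [hd]

/-! ### Families of tori in the Semmes space -/

/-- The tori over the points of a disc near the boundary of the tube, moved by `φ̃_w`, belong to the
family of the word `w`. -/
theorem SemmesData.exists_tori_subset_image {k : ℕ} (S : SemmesData k) {r : ℝ}
    (hr : ∀ i p, ‖((S.A.P.bb k i p).1 : ℂ)‖ ≤ r) {c : ℂ} {δ : ℝ} (hδ : 0 < δ)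
    (h : Metric.ball c δ ⊆ Metric.closedBall 0 1) (hball : ∀ z ∈ Metric.ball c δ, r < ‖z‖ ∧ ‖z‖ < 1)
    (w : List (Fin 2)) (z : ℂ) : ∃ s ∈ S.tori w,
      s ⊆ (fun x => S.R.ρ (S.A.ϑ (S.A.P.word k w (tubeParam k hδ h (z, x))))) ''
        univ.pi fun _ => Icc (-Real.pi) Real.pi := by
  obtain ⟨h1, h2⟩ := hball _ (tubeParam_fst_mem_ball hδ h ((z, 0) : ℂ × (Fin (k + 1) → ℝ)))
  refine ⟨_, ⟨_, BingPackage.image_fiber_mem_coreTori hr h1 h2 w, rfl⟩, ?_⟩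
  rintro _ ⟨_, ⟨p, hp, rfl⟩, rfl⟩
  refine ⟨fun j => Complex.arg (p.2 j), fun j _ => ⟨(Complex.neg_pi_lt_arg _).le,
    Complex.arg_le_pi _⟩, ?_⟩
  have : tubeParam k hδ h (z, fun j => Complex.arg (p.2 j)) = p :=
    Prod.ext (Subtype.ext hp.symm) (funext fun j => Circle.exp_arg _)
  exact congrArg (fun q => S.R.ρ (S.A.ϑ (S.A.P.word k w q))) this

/-- Finitely many pieces, on each of which the map into the Semmes space is bilipschitz, cover a compact
part of the parameter space. -/
theorem SemmesData.exists_finite_cover {k : ℕ} (S : SemmesData k) {c : ℂ} {δ : ℝ}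
    (hδ : 0 < δ) (h : Metric.ball c δ ⊆ Metric.closedBall 0 1)
    (hsing : ∀ v, tubeParam k hδ h v ∉ S.A.P.singularSet k)
    {Q : Set (ℂ × (Fin (k + 1) → ℝ))} (hQ : IsCompact Q) :
    ∃ (C : ℝ≥0) (N : ℕ) (V : Fin N → Set (ℂ × (Fin (k + 1) → ℝ))), Q ⊆ ⋃ i, V i ∧
      ∀ i, ∀ a ∈ V i, ∀ b ∈ V i,
        ENNReal.ofReal (S.D.d (S.R.ρ (S.A.ϑ (tubeParam k hδ h a)))
          (S.R.ρ (S.A.ϑ (tubeParam k hδ h b)))) ≤ C * edist a b ∧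
        edist a b ≤ C * ENNReal.ofReal (S.D.d (S.R.ρ (S.A.ϑ (tubeParam k hδ h a)))
          (S.R.ρ (S.A.ϑ (tubeParam k hδ h b)))) := by
  choose C s hs hC using S.exists_bilipschitz_tubeParam hδ h hsing
  obtain ⟨t, -, ht⟩ := hQ.elim_nhds_subcover s fun v _ => hs v
  refine ⟨t.sup C, t.card, fun i => s (t.equivFin.symm i), fun v hv => ?_, fun i a ha b hb => ?_⟩
  · obtain ⟨u, hu, hvu⟩ := mem_iUnion₂.1 (ht hv)
    refine mem_iUnion.2 ⟨t.equivFin ⟨u, hu⟩, ?_⟩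
    simpa using hvu
  · have hle : (C (t.equivFin.symm i) : ℝ≥0∞) ≤ (t.sup C : ℝ≥0) :=
      ENNReal.coe_le_coe.2 (Finset.le_sup (f := C) (t.equivFin.symm i).2)
    obtain ⟨h1, h2⟩ := hC _ a ha b hb
    exact ⟨h1.trans (by gcongr), h2.trans (by gcongr)⟩

/-- The Semmes condition turns the bilipschitz pieces of the parametrisation of `𝕋` into pieces for `𝕋_w`
that are bilipschitz up to the scaling factor `λ^|w|`, with a constant independent of `w`. -/
theorem SemmesData.exists_le_modulus_tori {k : ℕ} (S : SemmesData k) :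
    ∃ c₀ : ℝ, 0 < c₀ ∧ ∀ w : List (Fin 2), ENNReal.ofReal c₀ ≤
      modulus (k + 3) (k + 1) (((k + 3 : ℕ) : ℝ) / ((k + 1 : ℕ) : ℝ)) (S.tori w) := by
  obtain ⟨r, hr0, hr1, hr⟩ := S.A.P.exists_norm_bb_le k
  -- a disc in the annulus between the radii `r` and `1`
  have hδ : 0 < (1 - r) / 2 := by linarith
  have hball : ∀ z ∈ Metric.ball (((1 + r) / 2 : ℝ) : ℂ) ((1 - r) / 2), r < ‖z‖ ∧ ‖z‖ < 1 := by
    intro z hz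
    rw [Metric.mem_ball, dist_eq_norm] at hz
    have h1 : ‖(((1 + r) / 2 : ℝ) : ℂ)‖ = (1 + r) / 2 := by
      rw [Complex.norm_real, Real.norm_eq_abs, abs_of_nonneg (by linarith)]
    have h2 := norm_sub_norm_le (((1 + r) / 2 : ℝ) : ℂ) z
    have h3 := norm_sub_norm_le z (((1 + r) / 2 : ℝ) : ℂ)
    rw [norm_sub_rev] at h2
    constructor <;> linarith
  have h : Metric.ball (((1 + r) / 2 : ℝ) : ℂ) ((1 - r) / 2) ⊆ Metric.closedBall 0 1 :=
    fun z hz => mem_closedBall_zero_iff.2 (hball z hz).2.le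
  have hsing : ∀ v, tubeParam k hδ h v ∉ S.A.P.singularSet k := fun v =>
    BingPackage.notMem_singularSet hr (hball _ (tubeParam_fst_mem_ball hδ h v)).1
  set T₀ : Set (Fin (k + 1) → ℝ) := univ.pi fun _ => Icc (-Real.pi) Real.pi
  have hT₀ : IsCompact T₀ := isCompact_univ_pi fun _ => isCompact_Icc
  have hK₀ : IsCompact (Metric.closedBall (0 : ℂ) 1) := isCompact_closedBall _ _
  obtain ⟨C, N, V, hV, hC⟩ := S.exists_finite_cover hδ h hsing (hK₀.prod hT₀)
  obtain ⟨L, hL1, hL⟩ := S.semmes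
  have hL0 : 0 < L := by linarith
  lift L to ℝ≥0 using hL0.le
  obtain ⟨lam, hlam⟩ : ∃ lam : ℝ≥0, (lam : ℝ) = S.lam := ⟨⟨S.lam, S.lam_pos.le⟩, rfl⟩
  have hlam0 : 0 < lam := by rw [← NNReal.coe_pos, hlam]; exact S.lam_pos
  rw [← hlam] at hL
  obtain ⟨c₀, hc₀, H⟩ := exists_le_modulus_of_slices k N (C * L) hK₀.measurableSet
    (Metric.measure_closedBall_pos _ _ one_pos).ne' hK₀.measure_lt_top.ne hT₀.measure_lt_top.ne
    S.D.Space
  refine ⟨c₀, hc₀, fun w => ?_⟩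
  have hcont : Continuous fun v => S.R.ρ (S.A.ϑ (S.A.P.word k w (tubeParam k hδ h v))) :=
    S.R.continuous.comp (S.A.continuous_ϑ.comp
      ((S.A.P.continuous_word k w).comp (continuous_tubeParam hδ h)))
  let f : ℂ × (Fin (k + 1) → ℝ) → S.D.Space :=
    fun v => S.R.ρ (S.A.ϑ (S.A.P.word k w (tubeParam k hδ h v)))
  have hf : Continuous f := hcont
  have hfd : ∀ a b, edist (f a) (f b) = ENNReal.ofReal (S.D.d
      (S.R.ρ (S.A.ϑ (S.A.P.word k w (tubeParam k hδ h a))))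
      (S.R.ρ (S.A.ϑ (S.A.P.word k w (tubeParam k hδ h b))))) := fun a b => edist_dist _ _
  have hs : 0 < lam ^ w.length := pow_pos hlam0 _
  refine H f hf.measurable V hV (lam ^ w.length) hs (fun i a ha b hb => ?_) (fun i a ha b hb => ?_)
    (S.tori w) fun z _ => S.exists_tori_subset_image hr hδ h hball w z
  · rw [hfd]
    refine (ENNReal.ofReal_le_ofReal (hL w _ _).2).trans ?_
    rw [← NNReal.coe_pow, ← NNReal.coe_mul, ENNReal.ofReal_mul (NNReal.coe_nonneg _),
      ENNReal.ofReal_coe_nnreal]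
    calc ((L * lam ^ w.length : ℝ≥0) : ℝ≥0∞) * _
        ≤ ((L * lam ^ w.length : ℝ≥0) : ℝ≥0∞) * (C * edist a b) := by
          gcongr
          exact (hC i a ha b hb).1
      _ = _ := by push_cast; ring
  · rw [hfd]
    refine (hC i a ha b hb).2.trans ?_
    have h1 := (hL w (tubeParam k hδ h a) (tubeParam k hδ h b)).1
    rw [div_mul_eq_mul_div, div_le_iff₀ hL0, mul_comm, ← le_div_iff₀ (by exact_mod_cast hs)] at h1
    have h2 : S.D.d (S.R.ρ (S.A.ϑ (S.A.P.word k w (tubeParam k hδ h a))))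
        (S.R.ρ (S.A.ϑ (S.A.P.word k w (tubeParam k hδ h b)))) * L / (lam : ℝ) ^ w.length =
        ((L / lam ^ w.length : ℝ≥0) : ℝ) *
          S.D.d (S.R.ρ (S.A.ϑ (S.A.P.word k w (tubeParam k hδ h a))))
            (S.R.ρ (S.A.ϑ (S.A.P.word k w (tubeParam k hδ h b)))) := by
      push_cast
      ring
    rw [mul_div_assoc C, ENNReal.coe_mul, mul_assoc, ← ENNReal.ofReal_coe_nnreal (p := L / _),
      ← ENNReal.ofReal_mul (NNReal.coe_nonneg _), ← h2]
    gcongr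

end BingBlankinship

end

/-- Here `n = k + 3` runs through all integers `n ≥ 3`, so that `n - 2 = k + 1`. -/
theorem mainTheorem6 (k : ℕ) (S : BingBlankinship.SemmesData k) :
    ∃ c₀ : ℝ, 0 < c₀ ∧ ∀ w : List (Fin 2),
      ENNReal.ofReal c₀ ≤
        BingBlankinship.modulus (k + 3) (k + 1) (((k + 3 : ℕ) : ℝ) / ((k + 1 : ℕ) : ℝ))
          (S.tori w) := by
  exact S.exists_le_modulus_tori
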